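/- Let $S=K[x_1,\dots,x_n]$ be the polynomial ring over a field $K$, with its standard $\mathbb{Z}^n$-grading, and let $\mathfrak m=(x_1,\dots,x_n)$, $K=S/\mathfrak m$. For $\mathbf a\in\mathbb{Z}_{\ge0}^n$ write $\mathbf x^{\mathbf a}=x_1^{a_1}\cdots x_n^{a_n}$ and $|\mathbf a|=a_1+\dots+a_n$. For a monomial ideal $J\subset S$ and $i\ge0$, the $i$th homological shift ideal of $J$ is the monomial ideal $$\mathrm{HS}_i(J)=\bigl(\mathbf x^{\mathbf a}:\ \mathrm{Tor}_i^S(K,J)_{\mathbf a}\neq0\bigr).$$ A discrete polymatroid is a nonempty finite set $P\subset\mathbb{Z}_{\ge0}^n$ such that (a) if $\mathbf u\in P$ and $\mathbf v\in\mathbb{Z}_{\ge0}^n$ with $\mathbf v\le\mathbf u$ componentwise, then $\mathbf v\in P$; (b) if $\mathbf u,\mathbf v\in P$ and $|\mathbf u|<|\mathbf v|$, then there is $i$ with $u_i<v_i$ and $\mathbf u+\mathbf e_i\in P$, where $\mathbf e_i$ is the $i$th unit vector. Its bases are its maximal vectors with respect to $\le$. A monomial ideal $I\subset S$ is called polymatroidal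 if the exponent vectors of its minimal monomial generators form the set of bases of a discrete polymatroid. **Theorem.** Let $I\subset S$ be a polymatroidal ideal. Then $$\mathrm{HS}_1(I^{k+1})=I\cdot\mathrm{HS}_1(I^k)\qquad\text{for all }k\ge1.$$ In particular, the first homological shift algebra $\mathrm{HS}_1(\mathcal R(I))=\bigoplus_{k\ge1}\mathrm{HS}_1(I^k)t^k\subset S[t]$ is a module over the Rees algebra $\mathcal R(I)=\bigoplus_{k\ge0}I^kt^k\subset S[t]$, and it is generated as an $\mathcal R(I)$-module by its component $\mathrm{HS}_1(I)\,t$ of degree one. -/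

import Mathlib

open MvPolynomial

noncomputable section

namespace HomShift

/-- A discrete polymatroid on the ground set `{0, …, n - 1}`: a nonempty finite set of vectors of
nonnegative integers which is closed under passing to componentwise smaller vectors and which
satisfies the augmentation property. -/
structure IsDiscretePolymatroid {n : ℕ} (P : Set (Fin n →₀ ℕ)) : Prop where
  nonempty : P.Nonempty
  finite : P.Finite
  lower : ∀ u ∈ P, ∀ v : Fin n →₀ ℕ, v ≤ u → v ∈ P
  augment : ∀ u ∈ P, ∀ v ∈ P, ∑ i, u i < ∑ i, v i →
    ∃ i, u i < v i ∧ u + Finsupp.single i 1 ∈ P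

/-- The bases of a discrete polymatroid are its maximal vectors. -/
def bases {n : ℕ} (P : Set (Fin n →₀ ℕ)) : Set (Fin n →₀ ℕ) :=
  {u | Maximal (fun w => w ∈ P) u}

/-- The polynomial ring `K[x_0, …, x_{n-1}]`. -/
abbrev PolyRing (n : ℕ) (K : Type*) [Field K] : Type _ := MvPolynomial (Fin n) K

variable {n : ℕ} {K : Type*} [Field K]

/-- An ideal generated by a set of monomials. -/
def IsMonomialIdeal (I : Ideal (PolyRing n K)) : Prop :=
  ∃ A : Set (Fin n →₀ ℕ), I = Ideal.span ((fun a => monomial a (1 : K)) '' A)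

/-- The exponent vectors of the minimal monomial generators of `I`: those `a` such that `x^a ∈ I`
and no proper divisor of `x^a` lies in `I`. -/
def minGenExponents (I : Ideal (PolyRing n K)) : Set (Fin n →₀ ℕ) :=
  {a | Minimal (fun b => monomial b (1 : K) ∈ I) a}

/-- A polymatroidal ideal: a monomial ideal such that the exponent vectors of its minimal monomial
generators form the set of bases of a discrete polymatroid. -/
def IsPolymatroidal (I : Ideal (PolyRing n K)) : Prop :=
  IsMonomialIdeal I ∧
    ∃ P : Set (Fin n →₀ ℕ), IsDiscretePolymatroid P ∧ minGenExponents I = bases P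

/-- The sign of `x_j` in the Koszul differential of the basis vector `e_{G ∪ {j}}`: minus one to
the number of elements of `G` before `j`. -/
def koszulSign (G : Finset (Fin n)) (j : Fin n) : ℤ :=
  (-1) ^ (G.filter (fun l => l < j)).card

/-- The Koszul differential on `⨁_F S e_F` (`F` ranging over the subsets of the variables), that
is `e_F ↦ ∑_{j ∈ F} (-1)^{#{l ∈ F : l < j}} x_j e_{F \ {j}}`, written in coordinates: `z` stands
for `∑_F z(F) e_F`. -/
def koszulD (n : ℕ) (K : Type*) [Field K] :
    (Finset (Fin n) → PolyRing n K) →ₗ[PolyRing n K] (Finset (Fin n) → PolyRing n K) where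
  toFun z G := ∑ j ∈ Gᶜ, (koszulSign G j : PolyRing n K) * X j * z (insert j G)
  map_add' z w := by
    funext G
    simp only [Pi.add_apply, mul_add, Finset.sum_add_distrib]
  map_smul' c z := by
    funext G
    simp only [Pi.smul_apply, smul_eq_mul, RingHom.id_apply, Finset.mul_sum]
    exact Finset.sum_congr rfl fun j _ => by ring

/-- The `i`-th term `⨁_{|F| = i} I e_F` of the complex `K(x; S) ⊗_S I`, where `K(x; S)` is the
Koszul complex of the variables, the (multigraded, minimal) free resolution of
`K = S / (x_0, …, x_{n-1})`. -/
def koszulChains (i : ℕ) (I : Ideal (PolyRing n K)) :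
    Submodule (PolyRing n K) (Finset (Fin n) → PolyRing n K) where
  carrier := {z | ∀ F, z F ∈ I ∧ (F.card ≠ i → z F = 0)}
  add_mem' := by
    intro z w hz hw F
    refine ⟨I.add_mem (hz F).1 (hw F).1, fun h => ?_⟩
    rw [Pi.add_apply, (hz F).2 h, (hw F).2 h, add_zero]
  zero_mem' := fun F => ⟨I.zero_mem, fun _ => rfl⟩
  smul_mem' := by
    intro c z hz F
    refine ⟨I.mul_mem_left c (hz F).1, fun h => ?_⟩
    rw [Pi.smul_apply, (hz F).2 h, smul_zero]

/-- The `i`-cycles of `K(x; S) ⊗_S I`. -/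
def koszulCycles (i : ℕ) (I : Ideal (PolyRing n K)) :
    Submodule (PolyRing n K) (Finset (Fin n) → PolyRing n K) :=
  koszulChains i I ⊓ LinearMap.ker (koszulD n K)

/-- The `i`-boundaries of `K(x; S) ⊗_S I`. -/
def koszulBoundaries (i : ℕ) (I : Ideal (PolyRing n K)) :
    Submodule (PolyRing n K) (Finset (Fin n) → PolyRing n K) :=
  (koszulChains (i + 1) I).map (koszulD n K)

theorem koszulD_comp_self (z : Finset (Fin n) → PolyRing n K) :
    koszulD n K (koszulD n K z) = 0 := by
  funext G
  simp only [koszulD, LinearMap.coe_mk, AddHom.coe_mk, Pi.zero_apply, Finset.mul_sum]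
  rw [Finset.sum_sigma']
  refine Finset.sum_involution (fun p _ => ⟨p.2, p.1⟩) ?_ ?_ ?_ ?_
  · rintro ⟨j, k⟩ h
    simp only [Finset.mem_sigma, Finset.mem_compl, Finset.mem_insert, not_or] at h
    obtain ⟨hj, hkj, hk⟩ := h
    have key : koszulSign G j * koszulSign (insert j G) k +
        koszulSign G k * koszulSign (insert k G) j = 0 := by
      unfold koszulSign
      rw [Finset.filter_insert, Finset.filter_insert]
      rcases lt_or_gt_of_ne hkj with hlt | hlt
      · rw [if_neg (not_lt.mpr hlt.le), if_pos hlt,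
          Finset.card_insert_of_notMem (by simp [hk])]
        ring
      · rw [if_pos hlt, if_neg (not_lt.mpr hlt.le),
          Finset.card_insert_of_notMem (by simp [hj])]
        ring
    have key' := congrArg (Int.cast : ℤ → PolyRing n K) key
    push_cast at key'
    rw [Finset.insert_comm j k]
    linear_combination (X j * X k * z (insert k (insert j G))) * key'
  · rintro ⟨j, k⟩ h _ heq
    simp only [Finset.mem_sigma, Finset.mem_compl, Finset.mem_insert, not_or] at h
    simp only [Sigma.mk.injEq, heq_eq_eq] at heq
    exact h.2.1 heq.1
  · rintro ⟨j, k⟩ h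
    simp only [Finset.mem_sigma, Finset.mem_compl, Finset.mem_insert, not_or] at h ⊢
    exact ⟨h.2.2, fun e => h.2.1 e.symm, h.1⟩
  · rintro ⟨j, k⟩ h
    rfl

theorem koszulBoundaries_le_cycles (i : ℕ) (I : Ideal (PolyRing n K)) :
    koszulBoundaries i I ≤ koszulCycles i I := by
  rintro _ ⟨z, hz, rfl⟩
  refine ⟨fun F => ⟨?_, fun hF => ?_⟩, koszulD_comp_self z⟩
  · exact I.sum_mem fun j _ => I.mul_mem_left _ (hz _).1
  · refine Finset.sum_eq_zero fun j hj => ?_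
    rw [(hz (insert j F)).2, mul_zero]
    rw [Finset.card_insert_of_notMem (Finset.mem_compl.mp hj)]
    omega

/-- The module `Tor_i^S(K, I)`, the `i`-th homology of `K(x; S) ⊗_S I` for the free resolution
`K(x; S)` of `K`. -/
abbrev TorModule (i : ℕ) (I : Ideal (PolyRing n K)) : Type _ :=
  koszulCycles i I ⧸ (koszulBoundaries i I).submoduleOf (koszulCycles i I)

/-- The elements of multidegree `a` of `⨁_F S e_F`, where `e_F` has multidegree the indicator
vector of `F`. -/
def koszulHomogeneous (K : Type*) [Field K] (a : Fin n →₀ ℕ) :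
    Submodule K (Finset (Fin n) → PolyRing n K) where
  carrier := {z | ∀ F, ∀ m ∈ (z F).support, m + ∑ j ∈ F, Finsupp.single j 1 = a}
  add_mem' := by
    classical
    intro z w hz hw F m hm
    rcases Finset.mem_union.mp (support_add hm) with h | h
    · exact hz F m h
    · exact hw F m h
  zero_mem' := by
    intro F m hm
    simp at hm
  smul_mem' := by
    intro c z hz F m hm
    exact hz F m (support_smul hm)

/-- The component `Tor_i^S(K, I)_a` of multidegree `a`: the classes of the cycles of
multidegree `a`. -/
def torComponent (i : ℕ) (I : Ideal (PolyRing n K)) (a : Fin n →₀ ℕ) :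
    Submodule K (TorModule i I) :=
  ((koszulHomogeneous K a).comap ((koszulCycles i I).subtype.restrictScalars K)).map
    (((koszulBoundaries i I).submoduleOf (koszulCycles i I)).mkQ.restrictScalars K)

/-- The `i`-th homological shift ideal `HS_i(I) = (x^a : Tor_i^S(K, I)_a ≠ 0)`. -/
def HS (i : ℕ) (I : Ideal (PolyRing n K)) : Ideal (PolyRing n K) :=
  Ideal.span ((fun a => monomial a (1 : K)) '' {a | torComponent i I a ≠ ⊥})

/-- The `i`-th homological shift algebra `⨁_{k ≥ 1} HS_i(I^k)`, realized as
`⨁_{k ≥ 1} HS_i(I^k) t^k` inside `S[t]`, like the Rees algebra `⨁_{k ≥ 0} I^k t^k`. -/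
def homShiftAlgebra (i : ℕ) (I : Ideal (PolyRing n K)) :
    Submodule (PolyRing n K) (Polynomial (PolyRing n K)) where
  carrier := {p | p.coeff 0 = 0 ∧ ∀ k, 1 ≤ k → p.coeff k ∈ HS i (I ^ k)}
  add_mem' := by
    intro p q hp hq
    refine ⟨by rw [Polynomial.coeff_add, hp.1, hq.1, add_zero], fun k hk => ?_⟩
    rw [Polynomial.coeff_add]
    exact Ideal.add_mem _ (hp.2 k hk) (hq.2 k hk)
  zero_mem' := ⟨Polynomial.coeff_zero 0, fun k _ => by
    rw [Polynomial.coeff_zero]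
    exact Ideal.zero_mem _⟩
  smul_mem' := by
    intro c p hp
    refine ⟨by rw [Polynomial.coeff_smul, hp.1, smul_zero], fun k hk => ?_⟩
    rw [Polynomial.coeff_smul]
    exact Ideal.mul_mem_left _ c (hp.2 k hk)

/-- The component `HS_i(I) t` of degree one of the `i`-th homological shift algebra. -/
def homShiftDegreeOne (i : ℕ) (I : Ideal (PolyRing n K)) :
    Set (Polynomial (PolyRing n K)) :=
  {p | p ∈ homShiftAlgebra i I ∧ ∀ k, k ≠ 1 → p.coeff k = 0}

end HomShift

end

/-! Let `B` be the set of exponents of the minimal generators of `I`. It has constant degree `d` and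
satisfies an exchange property (`IsExchangeSet`), and this property passes to Minkowski sums, so `k
• B` is an exchange set generating `I ^ k`.

The crux on the algebraic side is that such an ideal has linear first syzygies: `Tor_1` in
multidegree `a` is nonzero exactly when `a = u + e_i = v + e_j` with `u, v` in the set and `i ≠ j`
(`IsExchangeSet.torComponent_one_ne_bot_iff`). In multidegree `a` the homology is that of the upper
Koszul complex, and exchange makes its graph connected as soon as `|a| ≥ d + 2`.

The theorem then becomes an identity of sets of exponents, `linearSyzygyDegrees ((k + 1) • B) = B +
linearSyzygyDegrees (k • B)`. It follows from a dual exchange property, applied to a summand in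
which the coordinate `i` can be raised, while a summand from `B` is split off. -/

noncomputable section
namespace HomShift
variable {n : ℕ} {K : Type*} [Field K]

/-! ### Exchange sets and bases of discrete polymatroids -/

/-- A set of vectors of constant degree `d` with the exchange property of the bases of a discrete
polymatroid. -/
structure IsExchangeSet (d : ℕ) (B : Set (Fin n →₀ ℕ)) : Prop where
  degree_eq : ∀ u ∈ B, u.degree = d
  exchange : ∀ u ∈ B, ∀ v ∈ B, ∀ j, v j < u j →
    ∃ l, u l < v l ∧ ∃ w ∈ B, w + Finsupp.single j 1 = u + Finsupp.single l 1

theorem degree_eq_sum (u : Fin n →₀ ℕ) : u.degree = ∑ i, u i :=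
  Finsupp.degree_eq_sum u

theorem degree_le_degree {u v : Fin n →₀ ℕ} (h : u ≤ v) : u.degree ≤ v.degree := by
  rw [degree_eq_sum, degree_eq_sum]
  exact Finset.sum_le_sum fun i _ => h i

theorem eq_of_le_of_degree_le {u v : Fin n →₀ ℕ} (h : u ≤ v) (hd : v.degree ≤ u.degree) :
    u = v := by
  obtain ⟨c, rfl⟩ := exists_add_of_le h
  rw [map_add] at hd
  have : c = 0 := (Finsupp.degree_eq_zero_iff c).mp (by omega)
  rw [this, add_zero]

theorem exists_single_add_of_ne_zero {u : Fin n →₀ ℕ} (h : u ≠ 0) :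
    ∃ i c, u = Finsupp.single i 1 + c := by
  obtain ⟨i, hi⟩ := Finsupp.ne_iff.mp h
  have : Finsupp.single i 1 ≤ u := by
    rw [Finsupp.single_le_iff]
    rw [Finsupp.zero_apply] at hi
    omega
  obtain ⟨c, hc⟩ := exists_add_of_le this
  exact ⟨i, c, hc⟩

theorem exists_eq_single_of_degree_eq_one {u : Fin n →₀ ℕ} (h : u.degree = 1) :
    ∃ i, u = Finsupp.single i 1 := by
  obtain ⟨i, c, rfl⟩ := exists_single_add_of_ne_zero (u := u) (by rintro rfl; simp at h)
  rw [map_add, Finsupp.degree_single] at h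
  have : c = 0 := (Finsupp.degree_eq_zero_iff c).mp (by omega)
  exact ⟨i, by rw [this, add_zero]⟩

namespace IsDiscretePolymatroid

variable {P : Set (Fin n →₀ ℕ)}

theorem degree_le_of_mem_bases (hP : IsDiscretePolymatroid P) {u v : Fin n →₀ ℕ}
    (hu : u ∈ bases P) (hv : v ∈ P) : v.degree ≤ u.degree := by
  by_contra! h
  rw [degree_eq_sum, degree_eq_sum] at h
  obtain ⟨i, -, hi⟩ := hP.augment u hu.1 v hv h
  have := hu.2 hi le_self_add i
  simp at this

/-- Remove `e_j` from `u` and augment the result towards `v`. The augmented coordinate is not `j`,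
since `u j - 1 ≥ v j`; the new vector has the maximal degree, hence is a basis. -/
theorem isExchangeSet_bases (hP : IsDiscretePolymatroid P) :
    ∃ d, IsExchangeSet d (bases P) := by
  by_cases hne : (bases P).Nonempty
  swap
  · rw [Set.not_nonempty_iff_eq_empty] at hne
    exact ⟨0, by simp [hne], by simp [hne]⟩
  obtain ⟨b, hb⟩ := hne
  have hdeg : ∀ u ∈ bases P, u.degree = b.degree := fun u hu =>
    le_antisymm (hP.degree_le_of_mem_bases hb hu.1) (hP.degree_le_of_mem_bases hu hb.1)
  refine ⟨b.degree, hdeg, fun u hu v hv j hj => ?_⟩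
  have hle : Finsupp.single j 1 ≤ u := by rw [Finsupp.single_le_iff]; omega
  obtain ⟨c, hc⟩ := exists_add_of_le hle
  have hcP : c ∈ P := hP.lower u hu.1 c (by rw [hc]; exact le_add_self)
  have hdc : c.degree + 1 = b.degree := by
    have := hdeg u hu
    rw [hc, map_add, Finsupp.degree_single] at this
    omega
  obtain ⟨l, hl, hlP⟩ := hP.augment c hcP v hv.1 (by
    rw [← degree_eq_sum, ← degree_eq_sum, hdeg v hv]; omega)
  have hlj : l ≠ j := by
    rintro rfl
    rw [hc, Finsupp.add_apply, Finsupp.single_eq_same] at hj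
    omega
  refine ⟨l, ?_, c + Finsupp.single l 1, ⟨hlP, fun w hw hcw => ?_⟩, ?_⟩
  · rw [hc, Finsupp.add_apply, Finsupp.single_eq_of_ne hlj]
    omega
  · refine (eq_of_le_of_degree_le hcw ?_).ge
    rw [map_add, Finsupp.degree_single, hdc]
    exact hP.degree_le_of_mem_bases hb hw
  · rw [hc]; abel

end IsDiscretePolymatroid

/-! ### Minkowski sums and dual exchange -/

namespace IsExchangeSet

variable {d e : ℕ} {A B : Set (Fin n →₀ ℕ)}

/-- An exchange step from `u` towards `v` decreases the total excess over `v`. -/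
theorem degree_tsub_lt {u v w : Fin n →₀ ℕ} {j l : Fin n} (hj : v j < u j) (hl : u l < v l)
    (h : w + Finsupp.single j 1 = u + Finsupp.single l 1) :
    (w - v).degree < (u - v).degree := by
  have hjl : j ≠ l := by rintro rfl; omega
  have key : ∀ i, w i + Finsupp.single j 1 i = u i + Finsupp.single l 1 i := fun i => by
    rw [← Finsupp.add_apply, h, Finsupp.add_apply]
  rw [degree_eq_sum, degree_eq_sum]
  refine Finset.sum_lt_sum (fun i _ => ?_) ⟨j, Finset.mem_univ _, ?_⟩
  · have := key i
    rw [Finsupp.tsub_apply, Finsupp.tsub_apply]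
    rcases eq_or_ne i l with rfl | hi
    · rw [Finsupp.single_eq_same, Finsupp.single_eq_of_ne hjl.symm] at this
      omega
    · rw [Finsupp.single_eq_of_ne hi] at this
      omega
  · have := key j
    rw [Finsupp.single_eq_same, Finsupp.single_eq_of_ne hjl] at this
    rw [Finsupp.tsub_apply, Finsupp.tsub_apply]
    omega

theorem singleton_zero : IsExchangeSet 0 ({0} : Set (Fin n →₀ ℕ)) := by
  refine ⟨by simp, fun u hu v hv j hj => ?_⟩
  rw [Set.mem_singleton_iff] at hu hv
  subst hu hv
  exact absurd hj (lt_irrefl _)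

open Pointwise in
-- A single exchange in one summand may raise a coordinate that is not deficient in the sum. In that
-- case the sum still exceeds `v + v'` there, so one summand exceeds its own target and can be
-- exchanged again. The total excess of the two summands over `v` and `v'` drops each time, so the
-- walk stops.
theorem add (hA : IsExchangeSet d A) (hB : IsExchangeSet e B) : IsExchangeSet (d + e) (A + B) := by
  constructor
  · rintro _ ⟨u, hu, v, hv, rfl⟩
    change (u + v).degree = _
    rw [map_add, hA.degree_eq u hu, hB.degree_eq v hv]
  · rintro u hu _ ⟨v, hv, v', hv', rfl⟩ j hj
    have key : ∀ N : ℕ, ∀ w ∈ A, ∀ w' ∈ B, ∀ l, (w - v).degree + (w' - v').degree < N →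
        (w + w') + Finsupp.single j 1 = u + Finsupp.single l 1 → v l + v' l < w l + w' l →
        ∃ m, u m < (v + v') m ∧ ∃ z ∈ A + B,
          z + Finsupp.single j 1 = u + Finsupp.single m 1 := by
      intro N
      induction N with
      | zero => intro _ _ _ _ _ h; omega
      | succ N ih =>
        intro w hw w' hw' l hN hsum hl
        have step : ∀ x ∈ A, ∀ x' ∈ B, ∀ m,
            (x - v).degree + (x' - v').degree < (w - v).degree + (w' - v').degree →
            (x + x') + Finsupp.single l 1 = (w + w') + Finsupp.single m 1 →
            ∃ m, u m < (v + v') m ∧ ∃ z ∈ A + B,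
              z + Finsupp.single j 1 = u + Finsupp.single m 1 := by
          intro x hx x' hx' m hlt hm
          have hsum' : (x + x') + Finsupp.single j 1 = u + Finsupp.single m 1 := by
            have : (x + x' + Finsupp.single j 1) + Finsupp.single l 1
                = (u + Finsupp.single m 1) + Finsupp.single l 1 := by
              rw [add_right_comm, hm, add_right_comm, hsum, add_right_comm]
            exact add_right_cancel this
          by_cases hum : u m < (v + v') m
          · exact ⟨m, hum, x + x', Set.add_mem_add hx hx', hsum'⟩
          · refine ih x hx x' hx' m (by omega) hsum' ?_
            have h1 := DFunLike.congr_fun hsum' m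
            simp only [Finsupp.add_apply, Finsupp.single_eq_same] at h1 hum hj
            rcases eq_or_ne m j with rfl | hmj
            · rw [Finsupp.single_eq_same] at h1
              omega
            · rw [Finsupp.single_eq_of_ne hmj] at h1
              omega
        rcases lt_or_ge (v l) (w l) with h | h
        · obtain ⟨m, hm, x, hx, hxe⟩ := hA.exchange w hw v hv l h
          refine step x hx w' hw' m ?_ ?_
          · have := degree_tsub_lt h hm hxe
            omega
          · rw [add_right_comm, hxe, add_right_comm]
        · obtain ⟨m, hm, x, hx, hxe⟩ := hB.exchange w' hw' v' hv' l (by omega)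
          refine step w hw x hx m ?_ ?_
          · have := degree_tsub_lt (by omega) hm hxe
            omega
          · rw [add_assoc, hxe, add_assoc]
    obtain ⟨w, hw, w', hw', rfl⟩ := hu
    exact key _ w hw w' hw' j (Nat.lt_succ_self _) rfl hj

open Pointwise in
theorem nsmul (hB : IsExchangeSet d B) (k : ℕ) : IsExchangeSet (k * d) (k • B) := by
  induction k with
  | zero => rw [zero_mul, zero_nsmul]; exact singleton_zero
  | succ k ih => rw [succ_nsmul, add_mul, one_mul]; exact ih.add hB

/-- The dual exchange property: a coordinate of `u` which is not the largest possible one may be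
increased at the cost of another one. -/
theorem exists_add_single_eq (hB : IsExchangeSet d B) {u w : Fin n →₀ ℕ} (hu : u ∈ B) (hw : w ∈ B)
    {i : Fin n} (hi : u i < w i) :
    ∃ p, p ≠ i ∧ ∃ x ∈ B, x + Finsupp.single p 1 = u + Finsupp.single i 1 := by
  induction hN : (w - u).degree using Nat.strong_induction_on generalizing w with
  | _ N ih =>
    have hle : Finsupp.single i 1 ≤ w - u := by
      rw [Finsupp.single_le_iff, Finsupp.tsub_apply]; omega
    obtain ⟨c, hc⟩ := exists_add_of_le hle
    have hci : ∀ l, w l - u l = Finsupp.single i 1 l + c l := fun l => by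
      rw [← Finsupp.tsub_apply, hc, Finsupp.add_apply]
    -- If the only excess of `w` over `u` is one unit at `i`, equality of degrees forces `w = u +
    -- e_i - e_p`. Otherwise a further unit of excess, at `l` (possibly `l = i`), is exchanged away
    -- while `u i < w i` is kept.
    by_cases hc0 : c = 0
    · have h1 : w - u = Finsupp.single i 1 := by rw [hc, hc0, add_zero]
      have hadd : w + (u - w) = u + (w - u) := by
        ext l; simp only [Finsupp.add_apply, Finsupp.tsub_apply]; omega
      have hdeg := congrArg Finsupp.degree hadd
      rw [map_add, map_add, hB.degree_eq u hu, hB.degree_eq w hw, h1, Finsupp.degree_single] at hdeg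
      obtain ⟨p, hp⟩ := exists_eq_single_of_degree_eq_one (u := u - w) (by omega)
      refine ⟨p, ?_, w, hw, by rw [← hp, hadd, h1]⟩
      rintro rfl
      have := DFunLike.congr_fun hp p
      rw [Finsupp.tsub_apply, Finsupp.single_eq_same] at this
      omega
    · obtain ⟨l, hl⟩ := Finsupp.ne_iff.mp hc0
      rw [Finsupp.zero_apply] at hl
      have hul : u l < w l := by have := hci l; omega
      obtain ⟨m, hm, x, hx, hxe⟩ := hB.exchange w hw u hu l hul
      refine ih _ ?_ hx ?_ rfl
      · rw [← hN]; exact degree_tsub_lt hul hm hxe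
      · have h1 := DFunLike.congr_fun hxe i
        have h2 := hci i
        simp only [Finsupp.add_apply, Finsupp.single_eq_same] at h1 h2
        rcases eq_or_ne i l with rfl | hil
        · rw [Finsupp.single_eq_same] at h1
          omega
        · rw [Finsupp.single_eq_of_ne hil] at h1
          omega

end IsExchangeSet

/-! ### Linear syzygy degrees of multiples of an exchange set -/

/-- The vectors which cover two different elements of `B`. -/
def linearSyzygyDegrees (B : Set (Fin n →₀ ℕ)) : Set (Fin n →₀ ℕ) :=
  {a | ∃ i j, i ≠ j ∧ ∃ u ∈ B, ∃ v ∈ B, u + Finsupp.single i 1 = a ∧ v + Finsupp.single j 1 = a}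

open Pointwise in
theorem IsExchangeSet.linearSyzygyDegrees_succ_nsmul {d : ℕ} {B : Set (Fin n →₀ ℕ)}
    (hB : IsExchangeSet d B) {k : ℕ} (hk : 1 ≤ k) :
    linearSyzygyDegrees ((k + 1) • B) = B + linearSyzygyDegrees (k • B) := by
  have mk : ∀ {C : Set (Fin n →₀ ℕ)} {i p u x}, p ≠ i → u ∈ C → x ∈ C →
      x + Finsupp.single p 1 = u + Finsupp.single i 1 →
      u + Finsupp.single i 1 ∈ linearSyzygyDegrees C :=
    fun hpi hu hx h => ⟨_, _, hpi, _, hx, _, hu, h, rfl⟩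
  apply Set.Subset.antisymm
  · rintro a ⟨i, j, hij, u, hu, v, hv, rfl, hva⟩
    rw [succ_nsmul] at hu hv
    obtain ⟨u₁, hu₁, u₂, hu₂, rfl⟩ := hu
    obtain ⟨v₁, hv₁, v₂, hv₂, rfl⟩ := hv
    have hi := DFunLike.congr_fun hva i
    simp only [Finsupp.add_apply, Finsupp.single_eq_same, Finsupp.single_eq_of_ne hij] at hi
    -- Since `i ≠ j`, `v` exceeds `u` by one at `i`, so one of the two summands of `u` can be raised
    -- at `i` by dual exchange.
    rcases lt_or_ge (u₁ i) (v₁ i) with h | h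
    · obtain ⟨p, hpi, x, hx, hxe⟩ := (hB.nsmul k).exists_add_single_eq hu₁ hv₁ h
      refine ⟨u₂, hu₂, u₁ + Finsupp.single i 1, mk hpi hu₁ hx hxe, ?_⟩
      change u₂ + (u₁ + Finsupp.single i 1) = u₁ + u₂ + Finsupp.single i 1
      abel
    · obtain ⟨p, hpi, x, hx, hxe⟩ := hB.exists_add_single_eq hu₂ hv₂ (i := i) (by omega)
      -- The raised summand `u₂` must stay in the `k`-fold part, so another element `r` of `B` is
      -- split off from `u₁`; this needs `k ≥ 1`.
      obtain ⟨k, rfl⟩ := Nat.exists_eq_add_of_le' hk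
      rw [succ_nsmul] at hu₁ ⊢
      obtain ⟨t, ht, r, hr, rfl⟩ := hu₁
      refine ⟨r, hr, (t + u₂) + Finsupp.single i 1, mk hpi (Set.add_mem_add ht hu₂)
        (Set.add_mem_add ht hx) (by rw [add_assoc, hxe, add_assoc]), ?_⟩
      change r + (t + u₂ + Finsupp.single i 1) = t + r + u₂ + Finsupp.single i 1
      abel
  · rintro _ ⟨b, hb, _, ⟨i, j, hij, u, hu, v, hv, rfl, hva⟩, rfl⟩
    rw [succ_nsmul']
    exact ⟨i, j, hij, b + u, Set.add_mem_add hb hu, b + v, Set.add_mem_add hb hv,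
      add_assoc _ _ _, by rw [add_assoc, hva]⟩

/-! ### Monomial ideals and their generators -/

/-- The ideal generated by the monomials with exponent vector in `B`. -/
def monomialSpan (K : Type*) [Field K] (B : Set (Fin n →₀ ℕ)) : Ideal (PolyRing n K) :=
  Ideal.span ((fun a => monomial a (1 : K)) '' B)

open Pointwise in
theorem monomialSpan_add (A B : Set (Fin n →₀ ℕ)) :
    monomialSpan K (A + B) = monomialSpan K A * monomialSpan K B := by
  rw [monomialSpan, monomialSpan, monomialSpan, Ideal.span_mul_span']
  congr 1
  ext f
  simp only [Set.mem_image, Set.mem_add, Set.mem_mul]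
  constructor
  · rintro ⟨_, ⟨a, ha, b, hb, rfl⟩, rfl⟩
    exact ⟨_, ⟨a, ha, rfl⟩, _, ⟨b, hb, rfl⟩, by rw [monomial_mul, one_mul]⟩
  · rintro ⟨_, ⟨a, ha, rfl⟩, _, ⟨b, hb, rfl⟩, rfl⟩
    exact ⟨_, ⟨a, ha, b, hb, rfl⟩, by rw [monomial_mul, one_mul]⟩

open Pointwise in
theorem monomialSpan_nsmul (B : Set (Fin n →₀ ℕ)) (k : ℕ) :
    monomialSpan K (k • B) = monomialSpan K B ^ k := by
  induction k with
  | zero =>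
    rw [zero_nsmul, pow_zero, Ideal.one_eq_top, Ideal.eq_top_iff_one]
    exact Ideal.subset_span ⟨0, rfl, rfl⟩
  | succ k ih => rw [succ_nsmul, pow_succ, monomialSpan_add, ih]

theorem mem_monomialSpan {B : Set (Fin n →₀ ℕ)} {f : PolyRing n K} :
    f ∈ monomialSpan K B ↔ ∀ m ∈ f.support, ∃ b ∈ B, b ≤ m :=
  mem_ideal_span_monomial_image

theorem monomial_mem_monomialSpan {B : Set (Fin n →₀ ℕ)} {m : Fin n →₀ ℕ} {c : K} (hc : c ≠ 0) :
    monomial m c ∈ monomialSpan K B ↔ ∃ b ∈ B, b ≤ m := by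
  classical
  rw [mem_monomialSpan, support_monomial, if_neg hc]
  simp

theorem IsMonomialIdeal.eq_monomialSpan_minGenExponents {I : Ideal (PolyRing n K)}
    (hI : IsMonomialIdeal I) : I = monomialSpan K (minGenExponents I) := by
  apply le_antisymm
  · obtain ⟨A, hA⟩ := hI
    conv_lhs => rw [hA]
    rw [Ideal.span_le]
    rintro _ ⟨a, ha, rfl⟩
    have haI : monomial a (1 : K) ∈ I := by rw [hA]; exact Ideal.subset_span ⟨a, ha, rfl⟩
    obtain ⟨b, hba, hb⟩ := exists_minimal_le_of_wellFoundedLT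
      (fun b => monomial b (1 : K) ∈ I) a haI
    exact (monomial_mem_monomialSpan one_ne_zero).mpr ⟨b, hb, hba⟩
  · rw [monomialSpan, Ideal.span_le]
    rintro _ ⟨a, ha, rfl⟩
    exact ha.1

theorem IsPolymatroidal.exists_isExchangeSet {I : Ideal (PolyRing n K)} (hI : IsPolymatroidal I) :
    ∃ d B, IsExchangeSet d B ∧ I = monomialSpan K B := by
  obtain ⟨hmon, P, hP, hPI⟩ := hI
  obtain ⟨d, hd⟩ := hP.isExchangeSet_bases
  exact ⟨d, bases P, hd, hPI ▸ hmon.eq_monomialSpan_minGenExponents⟩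

/-! ### The Koszul complex in a fixed multidegree -/

theorem torComponent_ne_bot_iff {i : ℕ} {I : Ideal (PolyRing n K)} {a : Fin n →₀ ℕ} :
    torComponent i I a ≠ ⊥ ↔
      ∃ z ∈ koszulCycles i I, z ∈ koszulHomogeneous K a ∧ z ∉ koszulBoundaries i I := by
  rw [Submodule.ne_bot_iff]
  constructor
  · rintro ⟨_, ⟨z, hz, rfl⟩, hne⟩
    refine ⟨z, z.2, hz, fun hb => hne ?_⟩
    exact (Submodule.Quotient.mk_eq_zero _).mpr hb
  · rintro ⟨z, hzc, hza, hzb⟩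
    refine ⟨_, ⟨⟨z, hzc⟩, hza, rfl⟩, fun h => hzb ?_⟩
    rw [LinearMap.coe_restrictScalars, Submodule.mkQ_apply, Submodule.Quotient.mk_eq_zero] at h
    exact h

theorem koszulD_apply (z : Finset (Fin n) → PolyRing n K) (G : Finset (Fin n)) :
    koszulD n K z G = ∑ j ∈ Gᶜ, (koszulSign G j : PolyRing n K) * X j * z (insert j G) := rfl

theorem koszulSign_empty (j : Fin n) : koszulSign ∅ j = 1 := by
  simp [koszulSign]

theorem koszulSign_singleton_of_lt {i j : Fin n} (h : i < j) : koszulSign {i} j = -1 := by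
  simp [koszulSign, Finset.filter_singleton, h]

theorem koszulSign_singleton_of_gt {i j : Fin n} (h : j < i) : koszulSign {i} j = 1 := by
  simp [koszulSign, Finset.filter_singleton, h.le.not_gt]

/-- The element `x^{a - e_j} e_j` of multidegree `a` of the Koszul complex. -/
def koszulVertex (K : Type*) [Field K] (a : Fin n →₀ ℕ) (j : Fin n) :
    Finset (Fin n) → PolyRing n K :=
  Pi.single {j} (monomial (a - Finsupp.single j 1) 1)

theorem koszulVertex_singleton (a : Fin n →₀ ℕ) (j : Fin n) :
    koszulVertex K a j {j} = monomial (a - Finsupp.single j 1) 1 :=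
  Pi.single_eq_same _ _

theorem koszulVertex_of_ne (a : Fin n →₀ ℕ) {j : Fin n} {F : Finset (Fin n)} (h : F ≠ {j}) :
    koszulVertex K a j F = 0 :=
  Pi.single_eq_of_ne h _

theorem koszulVertex_mem_homogeneous {a : Fin n →₀ ℕ} {j : Fin n} (h : Finsupp.single j 1 ≤ a) :
    koszulVertex K a j ∈ koszulHomogeneous K a := by
  intro F m hm
  by_cases hF : F = {j}
  · subst hF
    rw [koszulVertex_singleton] at hm
    have := Finset.mem_singleton.mp (support_monomial_subset hm)
    rw [this, Finset.sum_singleton, tsub_add_cancel_of_le h]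
  · rw [koszulVertex_of_ne _ hF] at hm
    simp at hm

theorem koszulVertex_mem_chains {B : Set (Fin n →₀ ℕ)} {a u : Fin n →₀ ℕ} {j : Fin n} (hu : u ∈ B)
    (h : u + Finsupp.single j 1 ≤ a) : koszulVertex K a j ∈ koszulChains 1 (monomialSpan K B) := by
  intro F
  by_cases hF : F = {j}
  · subst hF
    rw [koszulVertex_singleton]
    exact ⟨(monomial_mem_monomialSpan one_ne_zero).mpr ⟨u, hu, le_tsub_of_add_le_right h⟩,
      fun h => absurd (Finset.card_singleton j) h⟩
  · rw [koszulVertex_of_ne _ hF]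
    exact ⟨Ideal.zero_mem _, fun _ => rfl⟩

theorem koszulD_apply_empty (z : Finset (Fin n) → PolyRing n K) :
    koszulD n K z ∅ = ∑ j, X j * z {j} := by
  rw [koszulD_apply, Finset.compl_empty]
  refine Finset.sum_congr rfl fun j _ => ?_
  rw [koszulSign_empty, Int.cast_one, one_mul]
  rfl

theorem koszulD_apply_of_ne_empty {I : Ideal (PolyRing n K)} {z : Finset (Fin n) → PolyRing n K}
    (hz : z ∈ koszulChains 1 I) {G : Finset (Fin n)} (hG : G ≠ ∅) : koszulD n K z G = 0 := by
  rw [koszulD_apply]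
  refine Finset.sum_eq_zero fun j hj => ?_
  rw [(hz (insert j G)).2, mul_zero]
  rw [Finset.card_insert_of_notMem (Finset.mem_compl.mp hj)]
  have := Finset.card_pos.mpr (Finset.nonempty_iff_ne_empty.mpr hG)
  omega

theorem koszulD_koszulVertex {a : Fin n →₀ ℕ} {j : Fin n} (h : Finsupp.single j 1 ≤ a) :
    koszulD n K (koszulVertex K a j) ∅ = monomial a 1 := by
  rw [koszulD_apply_empty, Finset.sum_eq_single j]
  · rw [koszulVertex_singleton, X, monomial_mul, one_mul, add_tsub_cancel_of_le h]
  · intro i _ hi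
    rw [koszulVertex_of_ne _ (by simpa using hi), mul_zero]
  · simp

/-- The Koszul differential of `x^c e_{i,j}`. -/
theorem koszulD_single_pair {i j : Fin n} (hij : i < j) (c : Fin n →₀ ℕ) :
    koszulD n K (Pi.single {i, j} (monomial c 1)) =
      koszulVertex K (c + Finsupp.single i 1 + Finsupp.single j 1) j -
        koszulVertex K (c + Finsupp.single i 1 + Finsupp.single j 1) i := by
  have hc : ∀ l, c + Finsupp.single l 1 = Finsupp.single l 1 + c := fun l => add_comm _ _
  funext G
  rw [koszulD_apply, Pi.sub_apply]
  by_cases hGj : G = {j}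
  · subst hGj
    rw [koszulVertex_singleton, koszulVertex_of_ne _ (by simpa using hij.ne'), sub_zero,
      Finset.sum_eq_single i]
    · rw [koszulSign_singleton_of_gt hij, Pi.single_eq_same, X, Int.cast_one, one_mul,
        monomial_mul, one_mul, add_tsub_cancel_right, hc]
    · intro l hl hli
      rw [Pi.single_eq_of_ne, mul_zero]
      intro h
      have : l ∈ ({i, j} : Finset (Fin n)) := h ▸ Finset.mem_insert_self _ _
      simp at this hl
      tauto
    · intro h; simp [hij.ne] at h
  by_cases hGi : G = {i}
  · subst hGi
    rw [koszulVertex_singleton, koszulVertex_of_ne _ (by simpa using hij.ne), zero_sub,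
      Finset.sum_eq_single j]
    · rw [koszulSign_singleton_of_lt hij, Finset.pair_comm, Pi.single_eq_same, X, Int.cast_neg,
        Int.cast_one, neg_one_mul, neg_mul, monomial_mul, one_mul, add_right_comm,
        add_tsub_cancel_right, hc]
    · intro l hl hlj
      rw [Pi.single_eq_of_ne, mul_zero]
      intro h
      have : l ∈ ({i, j} : Finset (Fin n)) := h ▸ Finset.mem_insert_self _ _
      simp at this hl
      tauto
    · intro h; simp [hij.ne'] at h
  rw [koszulVertex_of_ne _ hGj, koszulVertex_of_ne _ hGi, sub_zero]
  refine Finset.sum_eq_zero fun l hl => ?_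
  rw [Pi.single_eq_of_ne, mul_zero]
  intro h
  rw [Finset.mem_compl] at hl
  have hl' : l ∈ ({i, j} : Finset (Fin n)) := h ▸ Finset.mem_insert_self _ _
  have hG : G = ({i, j} : Finset (Fin n)).erase l := by rw [← h, Finset.erase_insert hl]
  rw [Finset.mem_insert, Finset.mem_singleton] at hl'
  rcases hl' with rfl | rfl
  · apply hGj
    rw [hG, Finset.erase_insert (by simpa using hij.ne)]
  · apply hGi
    rw [hG, Finset.pair_comm, Finset.erase_insert (by simpa using hij.ne')]

/-- Here `{i, j}` is an edge of the upper Koszul complex at `a`: the coefficient of `x^{a - e_i -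
e_j} e_{i,j}` lies in the ideal, and its differential is the difference of the two vertices up to
sign. -/
theorem koszulVertex_sub_mem_boundaries {B : Set (Fin n →₀ ℕ)} {a w : Fin n →₀ ℕ} {i j : Fin n}
    (hij : i ≠ j) (hw : w ∈ B) (h : w + Finsupp.single i 1 + Finsupp.single j 1 ≤ a) :
    koszulVertex K a j - koszulVertex K a i ∈ koszulBoundaries 1 (monomialSpan K B) := by
  wlog hlt : i < j generalizing i j
  · rw [← neg_sub]
    exact neg_mem (this hij.symm (by rwa [add_right_comm]) (by omega))
  obtain ⟨c, rfl⟩ := exists_add_of_le h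
  refine ⟨Pi.single {i, j} (monomial (w + c) 1), fun F => ?_, ?_⟩
  · by_cases hF : F = {i, j}
    · subst hF
      rw [Pi.single_eq_same]
      exact ⟨(monomial_mem_monomialSpan one_ne_zero).mpr ⟨w, hw, le_self_add⟩,
        fun h => absurd (Finset.card_pair hij) h⟩
    · rw [Pi.single_eq_of_ne hF]
      exact ⟨Ideal.zero_mem _, fun _ => rfl⟩
  · rw [koszulD_single_pair hlt]
    have : w + c + Finsupp.single i 1 + Finsupp.single j 1
        = w + Finsupp.single i 1 + Finsupp.single j 1 + c := by abel
    rw [this]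

/-! ### Linearity of the first syzygies -/

/-- In degrees larger than `d + 1`, any two vertices of the upper Koszul complex are joined. -/
theorem IsExchangeSet.koszulVertex_sub_mem_boundaries {d : ℕ} {B : Set (Fin n →₀ ℕ)}
    (hB : IsExchangeSet d B) {a u v : Fin n →₀ ℕ} {i j : Fin n} (hij : i ≠ j) (hu : u ∈ B)
    (hv : v ∈ B) (hua : u + Finsupp.single i 1 ≤ a) (hva : v + Finsupp.single j 1 ≤ a)
    (ha : d + 2 ≤ a.degree) :
    koszulVertex K a j - koszulVertex K a i ∈ koszulBoundaries 1 (monomialSpan K B) := by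
  have le_iff : ∀ (w : Fin n →₀ ℕ) (p q : Fin n), p ≠ q → w ≤ a → w p < a p → w q < a q →
      w + Finsupp.single p 1 + Finsupp.single q 1 ≤ a := by
    intro w p q hpq hwa hp hq l
    simp only [Finsupp.add_apply, Finsupp.single_apply]
    have := hwa l
    split_ifs with h1 h2 <;> subst_vars <;> omega
  have hui : u i < a i := by have := hua i; simp at this; omega
  have hvj : v j < a j := by have := hva j; simp at this; omega
  have hu_le : u ≤ a := le_self_add.trans hua
  have hv_le : v ≤ a := le_self_add.trans hva
  rcases lt_or_ge (u j) (a j) with huj | huj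
  · exact HomShift.koszulVertex_sub_mem_boundaries hij hu (le_iff u i j hij hu_le hui huj)
  -- Now `u j = a j > v j`. Exchanging at `j` gives `w = u - e_j + e_l`, which is still below `a`
  -- and leaves room at `j`; for `l ≠ i` it also leaves room at `i`.
  obtain ⟨l, hl, w, hw, hwe⟩ := hB.exchange u hu v hv j (by omega)
  have hlj : l ≠ j := by rintro rfl; omega
  have hval : ∀ p, w p + Finsupp.single j 1 p = u p + Finsupp.single l 1 p := fun p => by
    rw [← Finsupp.add_apply, hwe, Finsupp.add_apply]
  have hw_le : w ≤ a := by
    intro p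
    have h1 := hval p
    have h2 := hu_le p
    rcases eq_or_ne p l with rfl | hpl
    · rw [Finsupp.single_eq_same] at h1
      have := hv_le p
      omega
    · rw [Finsupp.single_eq_of_ne hpl] at h1
      omega
  have hwj : w j < a j := by
    have h1 := hval j
    rw [Finsupp.single_eq_same, Finsupp.single_eq_of_ne hlj.symm] at h1
    have := hu_le j
    omega
  have hw_eq : ∀ p, p ≠ l → w p ≤ u p := fun p hp => by
    have h1 := hval p
    rw [Finsupp.single_eq_of_ne hp] at h1
    omega
  by_cases hli : i = l
  swap
  · exact HomShift.koszulVertex_sub_mem_boundaries hij hw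
      (le_iff w i j hij hw_le ((hw_eq i hli).trans_lt hui) hwj)
  subst hli
  -- With room at a third index `m`, the path `i`, `m`, `j` has its first edge from `u` and its
  -- second from `w`. Without it, `u` agrees with `a` off `i`, so `|a| ≥ d + 2` gives `u i + 2 ≤ a
  -- i` and `w` still has room at `i`.
  by_cases hthird : ∃ m, m ≠ i ∧ u m < a m
  · obtain ⟨m, hmi, hm⟩ := hthird
    have hmj : m ≠ j := by rintro rfl; omega
    rw [← sub_add_sub_cancel _ (koszulVertex K a m)]
    exact add_mem
      (HomShift.koszulVertex_sub_mem_boundaries hmj hw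
        (le_iff w m j hmj hw_le ((hw_eq m hmi).trans_lt hm) hwj))
      (HomShift.koszulVertex_sub_mem_boundaries hmi.symm hu (le_iff u i m hmi.symm hu_le hui hm))
  · push Not at hthird
    refine HomShift.koszulVertex_sub_mem_boundaries hij hw (le_iff w i j hij hw_le ?_ hwj)
    have h1 := hval i
    rw [Finsupp.single_eq_same, Finsupp.single_eq_of_ne hij] at h1
    by_contra! h2
    have h3 : a ≤ u + Finsupp.single i 1 := by
      intro p
      rw [Finsupp.add_apply]
      rcases eq_or_ne p i with rfl | hp
      · rw [Finsupp.single_eq_same]; omega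
      · exact (hthird p hp).trans (Nat.le_add_right _ _)
    have := degree_le_degree h3
    rw [map_add, Finsupp.degree_single, hB.degree_eq u hu] at this
    omega

theorem coeff_X_mul_eq_zero_of_mem {d : ℕ} {B : Set (Fin n →₀ ℕ)} (hB : IsExchangeSet d B)
    {f : PolyRing n K} (hf : f ∈ monomialSpan K B) (l : Fin n) {m : Fin n →₀ ℕ}
    (hm : m.degree ≤ d) : coeff m (X l * f) = 0 := by
  classical
  rw [coeff_X_mul']
  split_ifs with hl
  · by_contra hne
    obtain ⟨b, hb, hbm⟩ := mem_monomialSpan.mp hf _ (mem_support_iff.mpr hne)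
    have h1 := degree_le_degree hbm
    have h2 : m - Finsupp.single l 1 + Finsupp.single l 1 = m := by
      apply tsub_add_cancel_of_le
      rw [Finsupp.single_le_iff]
      have := Finsupp.mem_support_iff.mp hl
      omega
    have h3 := congrArg Finsupp.degree h2
    rw [map_add, Finsupp.degree_single] at h3
    rw [hB.degree_eq b hb] at h1
    omega
  · rfl

/-- The Koszul differential has linear entries, so boundaries have coefficients in `𝔪 I`, which
starts in degree `d + 1`. -/
theorem coeff_eq_zero_of_mem_boundaries {d i : ℕ} {B : Set (Fin n →₀ ℕ)} (hB : IsExchangeSet d B)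
    {z : Finset (Fin n) → PolyRing n K} (hz : z ∈ koszulBoundaries i (monomialSpan K B))
    (F : Finset (Fin n)) {m : Fin n →₀ ℕ} (hm : m.degree ≤ d) : coeff m (z F) = 0 := by
  obtain ⟨w, hw, rfl⟩ := hz
  rw [koszulD_apply, coeff_sum]
  refine Finset.sum_eq_zero fun l _ => ?_
  rw [mul_comm (_ : PolyRing n K) (X l), mul_assoc]
  exact coeff_X_mul_eq_zero_of_mem hB (Ideal.mul_mem_left _ _ (hw _).1) l hm

/-- A `1`-chain of multidegree `a` is a combination of the elements `x^{a - e_j} e_j`. -/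
theorem eq_sum_koszulVertex {I : Ideal (PolyRing n K)} {a : Fin n →₀ ℕ}
    {z : Finset (Fin n) → PolyRing n K} (hz : z ∈ koszulChains 1 I)
    (hza : z ∈ koszulHomogeneous K a) :
    z = ∑ j, coeff (a - Finsupp.single j 1) (z {j}) • koszulVertex K a j := by
  classical
  funext F
  rw [Finset.sum_apply]
  by_cases hF : F.card = 1
  · obtain ⟨j, rfl⟩ := Finset.card_eq_one.mp hF
    rw [Finset.sum_eq_single j]
    · rw [Pi.smul_apply, koszulVertex_singleton, smul_monomial, smul_eq_mul, mul_one]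
      ext m
      rw [coeff_monomial]
      split_ifs with h
      · rw [h]
      · by_contra hne
        have := hza {j} m (mem_support_iff.mpr hne)
        rw [Finset.sum_singleton] at this
        exact h (by rw [← this, add_tsub_cancel_right])
    · intro i _ hij
      rw [Pi.smul_apply, koszulVertex_of_ne _ (by simpa using hij.symm), smul_zero]
    · simp
  · rw [(hz F).2 hF, Finset.sum_eq_zero]
    intro j _
    rw [Pi.smul_apply, koszulVertex_of_ne, smul_zero]
    rintro rfl
    exact hF (Finset.card_singleton j)

/-- The ideal defined by an exchange set has linear first syzygies. -/
theorem IsExchangeSet.torComponent_one_ne_bot_iff {d : ℕ} {B : Set (Fin n →₀ ℕ)}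
    (hB : IsExchangeSet d B) {a : Fin n →₀ ℕ} :
    torComponent 1 (monomialSpan K B) a ≠ ⊥ ↔ a ∈ linearSyzygyDegrees B := by
  rw [torComponent_ne_bot_iff]
  constructor
  · rintro ⟨z, ⟨hzc, hzk⟩, hza, hzb⟩
    by_contra ha
    apply hzb
    set c : Fin n → K := fun j => coeff (a - Finsupp.single j 1) (z {j}) with hc_def
    have hz : z = ∑ j, c j • koszulVertex K a j := eq_sum_koszulVertex hzc hza
    have hcB : ∀ j, c j ≠ 0 → ∃ u ∈ B, u + Finsupp.single j 1 ≤ a := by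
      intro j hj
      have hs := mem_support_iff.mpr hj
      obtain ⟨u, hu, hle⟩ := mem_monomialSpan.mp (hzc {j}).1 _ hs
      have := hza {j} _ hs
      rw [Finset.sum_singleton] at this
      exact ⟨u, hu, by rw [← this]; exact add_le_add_left hle _⟩
    -- Each vertex has differential `x^a`, so the cycle condition is that the coefficients sum to
    -- zero; `z` is then a combination of differences of vertices.
    have hsum : ∑ j, c j = 0 := by
      have h0 : koszulD n K z ∅ = 0 := congrFun hzk ∅
      rw [hz, map_sum, Finset.sum_apply] at h0
      have h1 : ∀ j, koszulD n K (c j • koszulVertex K a j) ∅ = monomial a (c j) := by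
        intro j
        rw [← algebraMap_smul (PolyRing n K) (c j), map_smul, Pi.smul_apply]
        by_cases hj : c j = 0
        · simp [hj]
        · obtain ⟨u, -, hu⟩ := hcB j hj
          rw [koszulD_koszulVertex (le_add_self.trans hu), algebraMap_smul, smul_monomial,
            smul_eq_mul, mul_one]
      rw [Finset.sum_congr rfl fun j _ => h1 j] at h0
      simpa [coeff_sum] using congrArg (coeff a) h0
    by_cases hall : ∀ j, c j = 0
    · rw [hz, Finset.sum_eq_zero fun j _ => by rw [hall j, zero_smul]]
      exact zero_mem _
    push Not at hall
    obtain ⟨i, hi⟩ := hall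
    obtain ⟨u, hu, hua⟩ := hcB i hi
    have hz' : z = ∑ j, c j • (koszulVertex K a j - koszulVertex K a i) := by
      simp only [smul_sub]
      rw [Finset.sum_sub_distrib, ← Finset.sum_smul, hsum, zero_smul, sub_zero, ← hz]
    rw [hz']
    refine sum_mem fun j _ => ?_
    by_cases hj : c j = 0
    · rw [hj, zero_smul]; exact zero_mem _
    by_cases hij : i = j
    · rw [hij, sub_self, smul_zero]; exact zero_mem _
    obtain ⟨v, hv, hva⟩ := hcB j hj
    rw [← algebraMap_smul (PolyRing n K) (c j)]
    refine Submodule.smul_mem _ _ (hB.koszulVertex_sub_mem_boundaries hij hu hv hua hva ?_)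
    -- If `|a| ≤ d + 1`, both covers are equalities and `a` would be a linear syzygy degree.
    by_contra! hd
    refine ha ⟨i, j, hij, u, hu, v, hv, eq_of_le_of_degree_le hua ?_,
      eq_of_le_of_degree_le hva ?_⟩
    · rw [map_add, Finsupp.degree_single, hB.degree_eq u hu]; omega
    · rw [map_add, Finsupp.degree_single, hB.degree_eq v hv]; omega
  · rintro ⟨i, j, hij, u, hu, v, hv, hua, hva⟩
    have hi : Finsupp.single i 1 ≤ a := hua ▸ le_add_self
    have hj : Finsupp.single j 1 ≤ a := hva ▸ le_add_self
    have hchain := sub_mem (koszulVertex_mem_chains (K := K) hu hua.le)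
      (koszulVertex_mem_chains hv hva.le)
    refine ⟨koszulVertex K a i - koszulVertex K a j, ⟨hchain, ?_⟩,
      sub_mem (koszulVertex_mem_homogeneous hi) (koszulVertex_mem_homogeneous hj), fun hb => ?_⟩
    · rw [SetLike.mem_coe, LinearMap.mem_ker]
      funext G
      by_cases hG : G = ∅
      · subst hG
        rw [map_sub, Pi.sub_apply, koszulD_koszulVertex hi, koszulD_koszulVertex hj, sub_self]
        rfl
      · exact koszulD_apply_of_ne_empty hchain hG
    -- The `e_i` component of this cycle is `x^u`, of degree `d`, too low for a boundary.
    · have := coeff_eq_zero_of_mem_boundaries hB hb {i} (hB.degree_eq u hu).le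
      rw [Pi.sub_apply, koszulVertex_singleton, koszulVertex_of_ne _ (by simpa using hij), sub_zero,
        ← hua, add_tsub_cancel_right, coeff_monomial, if_pos rfl] at this
      exact one_ne_zero this

/-! ### Homological shifts of powers and the Rees module structure -/

theorem IsExchangeSet.HS_one {d : ℕ} {B : Set (Fin n →₀ ℕ)} (hB : IsExchangeSet d B) :
    HS 1 (monomialSpan K B) = monomialSpan K (linearSyzygyDegrees B) := by
  rw [HS, monomialSpan]
  congr 2
  ext a
  exact hB.torComponent_one_ne_bot_iff

theorem IsPolymatroidal.HS_one_pow_succ {I : Ideal (PolyRing n K)} (hI : IsPolymatroidal I)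
    {k : ℕ} (hk : 1 ≤ k) : HS 1 (I ^ (k + 1)) = I * HS 1 (I ^ k) := by
  obtain ⟨d, B, hB, rfl⟩ := hI.exists_isExchangeSet
  rw [← monomialSpan_nsmul, ← monomialSpan_nsmul, (hB.nsmul _).HS_one, (hB.nsmul _).HS_one,
    hB.linearSyzygyDegrees_succ_nsmul hk, monomialSpan_add]

theorem IsPolymatroidal.HS_one_pow_add {I : Ideal (PolyRing n K)} (hI : IsPolymatroidal I)
    {k : ℕ} (hk : 1 ≤ k) (m : ℕ) : HS 1 (I ^ (m + k)) = I ^ m * HS 1 (I ^ k) := by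
  induction m with
  | zero => rw [zero_add, pow_zero, one_mul]
  | succ m ih =>
    rw [add_right_comm, hI.HS_one_pow_succ (by omega), ih, ← mul_assoc, pow_succ']

end HomShift

theorem theorem4p1 {n : ℕ} {K : Type*} [Field K] (I : Ideal (HomShift.PolyRing n K))
    (hI : HomShift.IsPolymatroidal I) :
    (∀ k : ℕ, 1 ≤ k → HomShift.HS 1 (I ^ (k + 1)) = I * HomShift.HS 1 (I ^ k)) ∧
    (∃ M : Submodule (reesAlgebra I) (Polynomial (HomShift.PolyRing n K)),
      M.restrictScalars (HomShift.PolyRing n K) = HomShift.homShiftAlgebra 1 I ∧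
      M = Submodule.span (reesAlgebra I) (HomShift.homShiftDegreeOne 1 I)) := by
  -- The closing `rfl` fixes the module to be the span of the degree-one component; the two
  -- inclusions remain.
  refine ⟨fun k hk => hI.HS_one_pow_succ hk, _, le_antisymm ?_ ?_, rfl⟩
  · intro p hp
    change p ∈ Submodule.span _ _ at hp
    induction hp using Submodule.span_induction with
    | mem p hp => exact hp.1
    | zero => exact zero_mem _
    | add p q _ _ hp hq => exact add_mem hp hq
    | smul r p _ hp =>
      have hr : ∀ i, (r : Polynomial (HomShift.PolyRing n K)).coeff i ∈ I ^ i :=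
        (mem_reesAlgebra_iff _ _).mp r.2
      change (r : Polynomial (HomShift.PolyRing n K)) * p ∈ _
      refine ⟨by rw [Polynomial.mul_coeff_zero, hp.1, mul_zero], fun k hk => ?_⟩
      rw [Polynomial.coeff_mul]
      refine Ideal.sum_mem _ fun x hx => ?_
      rw [Finset.HasAntidiagonal.mem_antidiagonal] at hx
      rcases Nat.eq_zero_or_pos x.2 with h0 | h0
      · rw [h0, hp.1, mul_zero]; exact zero_mem _
      · rw [← hx, hI.HS_one_pow_add h0]
        exact Ideal.mul_mem_mul (hr _) (hp.2 _ h0)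
  · intro p hp
    change p ∈ Submodule.span _ _
    rw [p.as_sum_support]
    refine sum_mem fun k hk => ?_
    obtain ⟨m, rfl⟩ : ∃ m, k = m + 1 := by
      refine Nat.exists_eq_succ_of_ne_zero ?_
      rintro rfl
      exact Polynomial.mem_support_iff.mp hk hp.1
    have hcoeff := hp.2 (m + 1) (by omega)
    -- The coefficient lies in `I ^ m * HS 1 (I ^ 1)`, so its term is a sum of products `(r t^m)(s
    -- t)`.
    rw [hI.HS_one_pow_add le_rfl] at hcoeff
    refine Submodule.mul_induction_on hcoeff (fun r hr s hs => ?_) (fun x y hx hy => ?_)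
    · have hs' : Polynomial.monomial 1 s ∈ HomShift.homShiftDegreeOne 1 I := by
        refine ⟨⟨Polynomial.coeff_monomial_of_ne _ (by omega), fun k _ => ?_⟩, fun k hk =>
          Polynomial.coeff_monomial_of_ne _ hk⟩
        by_cases hk1 : k = 1
        · subst hk1
          rwa [Polynomial.coeff_monomial_same]
        · rw [Polynomial.coeff_monomial_of_ne _ hk1]
          exact zero_mem _
      have := Submodule.smul_mem _
        (⟨Polynomial.monomial m r, reesAlgebra.monomial_mem.mpr hr⟩ : reesAlgebra I)
        (Submodule.subset_span (R := reesAlgebra I) hs')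
      rwa [show (⟨Polynomial.monomial m r, reesAlgebra.monomial_mem.mpr hr⟩ : reesAlgebra I) •
        Polynomial.monomial 1 s = Polynomial.monomial (m + 1) (r * s) from
          Polynomial.monomial_mul_monomial _ _ _ _] at this
    · rw [map_add]
      exact add_mem hx hy

end
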